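/- Let $p\ge 3$, let $X\sim N_p(\theta,I_p)$ with $\theta\in\mathbb R^p$ unknown, and let $R(\theta,\hat\theta)=\mathrm E_\theta\|\hat\theta(X)-\theta\|^2$. For a function $\phi$ on $(0,\infty)$ let $\hat\theta_\phi=\bigl(1-\phi(\|X\|^2)/\|X\|^2\bigr)X$, and let $\hat\theta_{\mathrm{JS}}=\bigl(1-(p-2)/\|X\|^2\bigr)X$ be the James--Stein estimator. An estimator $\hat\theta$ dominates $\hat\theta_{\mathrm{JS}}$ if $R(\theta,\hat\theta)\le R(\theta,\hat\theta_{\mathrm{JS}})$ for every $\theta\in\mathbb R^p$, with strict inequality for at least one $\theta$. (i) Suppose that $\phi$ is differentiable on $(0,\infty)$ with $\phi'\ge 0$ and $\phi\ge 0$, that $\phi(w)\to p-2$ as $w\to\infty$, that $\phi(w)\ne p-2$ for all $w>0$, and that $w\phi'(w)/\{p-2-\phi(w)\}^2$ is non-decreasing on $(0,\infty)$. If $R(0,\hat\theta_\phi)\le R(0,\hat\theta_{\mathrm{JS}})$, then $\hat\theta_\phi$ dominates $\hat\theta_{\mathrm{JS}}$. (ii) Let $\Phi$ be a non-decreasing function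 on $(0,\infty)$ that is positive, or more generally non-negative and not identically zero, with $\int_0^w t^{-1}\Phi(t)\,dt<\infty$ for all $w>0$, let $C\ge 1/(p-2)$, and let $$\phi(w)=p-2-\frac{1}{\int_0^w t^{-1}\Phi(t)\,dt+C}.$$ If $R(0,\hat\theta_\phi)\le R(0,\hat\theta_{\mathrm{JS}})$, then $\hat\theta_\phi$ dominates $\hat\theta_{\mathrm{JS}}$. (iii) The functions $\phi$ that satisfy the conditions of (i) preceding the inequality at $\theta=0$ are exactly the functions on $(0,\infty)$ of the form given in (ii) with $\Phi$ continuous. -/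

import Mathlib

open MeasureTheory ProbabilityTheory Set Filter Topology
open scoped ENNReal

/-- Risk `R(θ, δ) = E_θ ‖δ(X) - θ‖²` of the estimator `δ` under quadratic loss,
where `X ∼ N_p(θ, I_p)`. It takes values in `[0, ∞]`. -/
noncomputable def risk {p : ℕ}
    (δ : EuclideanSpace ℝ (Fin p) → EuclideanSpace ℝ (Fin p))
    (θ : EuclideanSpace ℝ (Fin p)) : ℝ≥0∞ :=
  ∫⁻ x, ‖δ x - θ‖ₑ ^ 2 ∂(multivariateGaussian θ (1 : Matrix (Fin p) (Fin p) ℝ))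

/-- `δ` dominates `δ₀`: its risk is nowhere larger, and it is strictly smaller somewhere. -/
def Dominates {p : ℕ}
    (δ δ₀ : EuclideanSpace ℝ (Fin p) → EuclideanSpace ℝ (Fin p)) : Prop :=
  (∀ θ, risk δ θ ≤ risk δ₀ θ) ∧ ∃ θ, risk δ θ < risk δ₀ θ

/-- The shrinkage estimator `(1 - φ(‖X‖²) / ‖X‖²) X`. -/
noncomputable def shrinkageEstimator (p : ℕ) (φ : ℝ → ℝ)
    (x : EuclideanSpace ℝ (Fin p)) : EuclideanSpace ℝ (Fin p) :=
  (1 - φ (‖x‖ ^ 2) / ‖x‖ ^ 2) • x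

/-- The James–Stein estimator `(1 - (p - 2) / ‖X‖²) X`. -/
noncomputable def jamesStein (p : ℕ)
    (x : EuclideanSpace ℝ (Fin p)) : EuclideanSpace ℝ (Fin p) :=
  (1 - ((p : ℝ) - 2) / ‖x‖ ^ 2) • x

/-- The conditions on the shrinkage function `φ` (regarded as a function on `(0, ∞)`) other than
dominance at the origin. The field `ne` says that the quotient in `monotone_quotient` is
well defined. -/
structure ShrinkageConditions (p : ℕ) (φ : ℝ → ℝ) : Prop where
  differentiable : DifferentiableOn ℝ φ (Ioi 0)
  deriv_nonneg : ∀ w, 0 < w → 0 ≤ deriv φ w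
  nonneg : ∀ w, 0 < w → 0 ≤ φ w
  tendsto : Tendsto φ atTop (𝓝 ((p : ℝ) - 2))
  ne : ∀ w, 0 < w → φ w ≠ (p : ℝ) - 2
  monotone_quotient :
    MonotoneOn (fun w => w * deriv φ w / ((p : ℝ) - 2 - φ w) ^ 2) (Ioi 0)

/-- The conditions on `Φ` (regarded as a function on `(0, ∞)`): non-negative, not identically
zero, non-decreasing, and such that the integrals `∫₀^w t⁻¹ Φ(t) dt` exist. Every positive
non-decreasing `Φ` for which these integrals exist is included. -/
structure RateConditions (Φ : ℝ → ℝ) : Prop where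
  nonneg : ∀ w, 0 < w → 0 ≤ Φ w
  exists_pos : ∃ w, 0 < w ∧ 0 < Φ w
  monotone : MonotoneOn Φ (Ioi 0)
  integrable : ∀ w, 0 < w → IntervalIntegrable (fun t => t⁻¹ * Φ t) volume 0 w

/-- The function `φ(w) = p - 2 - 1 / (∫₀^w t⁻¹ Φ(t) dt + C)`. -/
noncomputable def shrinkageOfRate (p : ℕ) (Φ : ℝ → ℝ) (C : ℝ) (w : ℝ) : ℝ :=
  (p : ℝ) - 2 - 1 / ((∫ t in (0 : ℝ)..w, t⁻¹ * Φ t) + C)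

/-! Write `φ = p - 2 - 1/M` with `M(w) = ∫₀^w t⁻¹ Φ(t) dt + C`, put `γ(r) = 1/M(r²)`, `p = n + 3`,
and let `c = ⟨θ, u⟩` for a unit vector `u`. In polar coordinates the loss difference along the ray
of `u` is a quadratic in `γ`. One integration by parts in `r` removes its linear terms, because `r
γ' = -2 Φ(r²) γ²`. What remains, up to a positive factor depending only on `θ`, is `I(c) = ∫ rⁿ γ²
(1 - 4 Φ(r²)) exp(-r²/2 + r c) dr` (`RateConditions.integral_ray_eq`).

Averaging over `θ` and `-θ` turns `exp(r c)` into `cosh(r c)`, which increases with `r`. Since `Φ`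
is non-decreasing, `1 - 4Φ` changes sign at most once, from plus to minus; so if the integral is
non-positive at `c = 0`, it stays so for every `c` (`integral_mul_cosh_nonpos`). The hypothesis at
the origin says exactly `I(0) ≤ 0`. Integrability of `t⁻¹ Φ(t)` at `0` forces `Φ < 1/4` near `0`,
which gives strictness when `c ≠ 0`.

The conditions on `φ` reduce to this form through `ρ = 1/(p - 2 - φ)`, for which `w ρ'(w)` is the
monotone quotient `Φ`. Then `C = ρ(0+)`, and `Φ` is continuous since a monotone derivative has no
jumps (Darboux). -/

/-! ### Gaussian densities. -/

/-- The standard Gaussian measure on `ℝᵖ` has density `∏ᵢ gaussianPDF 0 1 xᵢ`. -/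
theorem pi_gaussianReal_eq_withDensity (p : ℕ) :
    Measure.pi (fun _ : Fin p => gaussianReal 0 1) =
      (volume : Measure (Fin p → ℝ)).withDensity (fun x => ∏ i, gaussianPDF 0 1 (x i)) := by
  refine Measure.pi_eq fun s hs => ?_
  rw [withDensity_apply _ (MeasurableSet.univ_pi hs), ← lintegral_indicator (MeasurableSet.univ_pi hs)]
  have : ((univ.pi s).indicator fun x : Fin p → ℝ => ∏ i, gaussianPDF 0 1 (x i)) =
      fun x => ∏ i, (s i).indicator (gaussianPDF 0 1) (x i) := by
    ext x
    by_cases hx : x ∈ univ.pi s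
    · rw [indicator_of_mem hx]
      exact Finset.prod_congr rfl fun i _ => (indicator_of_mem (hx i (mem_univ i)) _).symm
    · rw [indicator_of_notMem hx]
      obtain ⟨i, hi⟩ : ∃ i, x i ∉ s i := by simpa [mem_univ_pi] using hx
      exact (Finset.prod_eq_zero (Finset.mem_univ i) (indicator_of_notMem hi _)).symm
  -- The factorization of the integral is taken from the Bochner version of Fubini, hence the
  -- passage to real-valued densities.
  have hint : ∀ i, Integrable ((s i).indicator (gaussianPDFReal 0 1)) := fun i =>
    (integrable_gaussianPDFReal 0 1).indicator (hs i)
  have hnn : ∀ i y, 0 ≤ (s i).indicator (gaussianPDFReal 0 1) y := fun i y =>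
    indicator_nonneg (fun z _ => gaussianPDFReal_nonneg 0 1 z) y
  have hind : ∀ i y, (s i).indicator (gaussianPDF 0 1) y =
      ENNReal.ofReal ((s i).indicator (gaussianPDFReal 0 1) y) := by
    intro i y
    by_cases hy : y ∈ s i <;> simp [hy, gaussianPDF]
  rw [this]
  simp only [hind, ← ENNReal.ofReal_prod_of_nonneg fun i _ => hnn i _]
  have hprod : Integrable fun x : Fin p → ℝ => ∏ i, (s i).indicator (gaussianPDFReal 0 1) (x i) := by
    rw [volume_pi]
    exact Integrable.fintype_prod hint
  rw [← ofReal_integral_eq_lintegral_ofReal hprod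
    (ae_of_all _ fun x => Finset.prod_nonneg fun i _ => hnn i _),
    integral_fintype_prod_volume_eq_prod,
    ENNReal.ofReal_prod_of_nonneg fun i _ => integral_nonneg (hnn i)]
  refine Finset.prod_congr rfl fun i _ => ?_
  rw [ofReal_integral_eq_lintegral_ofReal (hint i) (ae_of_all _ (hnn i)),
    gaussianReal_of_var_ne_zero _ one_ne_zero, withDensity_apply _ (hs i),
    ← lintegral_indicator (hs i)]
  simp only [hind]

theorem stdGaussian_eq_withDensity (p : ℕ) :
    stdGaussian (EuclideanSpace ℝ (Fin p)) = volume.withDensity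
      (fun x => ENNReal.ofReal ((√(2 * Real.pi))⁻¹ ^ p * Real.exp (-‖x‖ ^ 2 / 2))) := by
  rw [← map_pi_eq_stdGaussian, pi_gaussianReal_eq_withDensity]
  ext s hs
  rw [Measure.map_apply (by fun_prop) hs,
    withDensity_apply _ (hs.preimage (by fun_prop)), withDensity_apply _ hs,
    ← (PiLp.volume_preserving_toLp (Fin p)).setLIntegral_comp_preimage hs (by fun_prop)]
  refine setLIntegral_congr_fun (hs.preimage (by fun_prop)) fun x _ => ?_
  simp only [gaussianPDF, gaussianPDFReal]
  rw [← ENNReal.ofReal_prod_of_nonneg fun i _ => by positivity, Finset.prod_mul_distrib,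
    ← Real.exp_sum, EuclideanSpace.real_norm_sq_eq]
  simp [Finset.sum_div, neg_div]

theorem multivariateGaussian_one_eq_withDensity {p : ℕ} (θ : EuclideanSpace ℝ (Fin p)) :
    multivariateGaussian θ (1 : Matrix (Fin p) (Fin p) ℝ) = volume.withDensity
      (fun x => ENNReal.ofReal ((√(2 * Real.pi))⁻¹ ^ p * Real.exp (-‖x - θ‖ ^ 2 / 2))) := by
  have h : multivariateGaussian θ (1 : Matrix (Fin p) (Fin p) ℝ) =
      (stdGaussian (EuclideanSpace ℝ (Fin p))).map (fun x => θ + x) := by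
    simp [multivariateGaussian]
  rw [h, stdGaussian_eq_withDensity]
  ext s hs
  rw [Measure.map_apply (by fun_prop) hs,
    withDensity_apply _ (hs.preimage (by fun_prop)), withDensity_apply _ hs,
    ← (measurePreserving_add_left volume θ).setLIntegral_comp_preimage hs (by fun_prop)]
  simp

/-! ### Polar coordinates. -/

/-- Fubini on sphere times half-line. Integrability over the sphere is recorded as well: the
symmetrization in `θ` adds two sphere integrals. -/
theorem integral_polar {E : Type*} [NormedAddCommGroup E] [NormedSpace ℝ E] [Nontrivial E]
    [FiniteDimensional ℝ E] [MeasurableSpace E] [BorelSpace E] (μ : Measure E)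
    [μ.IsAddHaarMeasure] {f : E → ℝ} (hf : Integrable f μ) :
    Integrable (fun u : Metric.sphere (0 : E) 1 =>
        ∫ r in Ioi (0 : ℝ), r ^ (Module.finrank ℝ E - 1) * f (r • (u : E))) μ.toSphere ∧
      ∫ x, f x ∂μ = ∫ u : Metric.sphere (0 : E) 1,
        (∫ r in Ioi (0 : ℝ), r ^ (Module.finrank ℝ E - 1) * f (r • (u : E))) ∂μ.toSphere := by
  set d := Module.finrank ℝ E - 1
  have hmp := μ.measurePreserving_homeomorphUnitSphereProd
  have hemb := (homeomorphUnitSphereProd E).measurableEmbedding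
  set F : Metric.sphere (0 : E) 1 × Ioi (0 : ℝ) → ℝ := fun y => f (y.2.1 • (y.1 : E)) with hF
  have hcomp : ∀ x : ({0}ᶜ : Set E), F (homeomorphUnitSphereProd E x) = f x := by
    intro x
    have hx : ‖(x : E)‖ ≠ 0 := norm_ne_zero_iff.2 x.2
    simp [hF, smul_smul, hx]
  have hint : Integrable F (μ.toSphere.prod (Measure.volumeIoiPow d)) := by
    rw [← hmp.integrable_comp_emb hemb]
    refine Integrable.congr (f := fun x : ({0}ᶜ : Set E) => f x) ?_
      (ae_of_all _ fun x => (hcomp x).symm)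
    exact (integrableOn_iff_comap_subtypeVal (measurableSet_singleton _).compl).1 hf.integrableOn
  have hinner : ∀ u : Metric.sphere (0 : E) 1,
      ∫ r, F (u, r) ∂(Measure.volumeIoiPow d) = ∫ r in Ioi (0 : ℝ), r ^ d * f (r • (u : E)) := by
    intro u
    simp only [Measure.volumeIoiPow, ENNReal.ofReal]
    rw [integral_withDensity_eq_integral_smul
      (measurable_subtype_coe.pow_const _).real_toNNReal,
      integral_subtype_comap measurableSet_Ioi
        fun a : ℝ => Real.toNNReal (a ^ d) • f (a • (u : E))]
    refine setIntegral_congr_fun measurableSet_Ioi fun x hx => ?_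
    simp only [NNReal.smul_def, smul_eq_mul]
    rw [Real.coe_toNNReal _ (pow_nonneg hx.out.le _)]
  refine ⟨?_, ?_⟩
  · simpa only [hinner] using hint.integral_prod_left
  · calc ∫ x, f x ∂μ = ∫ x : ({0}ᶜ : Set E), f x ∂(μ.comap (↑)) := by
          rw [integral_subtype_comap (measurableSet_singleton _).compl f, restrict_compl_singleton]
      _ = ∫ y, F y ∂(μ.toSphere.prod (Measure.volumeIoiPow d)) := by
          rw [← hmp.integral_comp hemb]
          exact integral_congr_ae (ae_of_all _ fun x => (hcomp x).symm)
      _ = _ := by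
          rw [integral_prod _ hint]
          simp only [hinner]

/-! ### Integration by parts along a ray. -/

/-- If `G` vanishes at `0` and at `∞`, its derivative has zero integral over `(0, ∞)`; the
derivative may fail to exist on a countable set. -/
theorem integral_Ioi_deriv_eq_zero {G G' : ℝ → ℝ} {s : Set ℝ} (hs : s.Countable)
    (hcont : ContinuousOn G (Ici 0)) (hG0 : G 0 = 0) (htop : Tendsto G atTop (𝓝 0))
    (hderiv : ∀ r ∈ Ioi (0 : ℝ) \ s, HasDerivAt G (G' r) r) (hint : IntegrableOn G' (Ioi 0)) :
    ∫ r in Ioi (0 : ℝ), G' r = 0 := by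
  refine tendsto_nhds_unique (intervalIntegral_tendsto_integral_Ioi 0 hint tendsto_id)
    (htop.congr' ?_)
  filter_upwards [eventually_ge_atTop 0] with T hT
  rw [id, integral_eq_of_hasDerivAt_off_countable_of_le G G' hT hs
    (hcont.mono Icc_subset_Ici_self) (fun r hr => hderiv r ⟨hr.1.1, hr.2⟩), hG0, sub_zero]
  exact (intervalIntegrable_iff_integrableOn_Ioc_of_le hT).2 (hint.mono_set Ioc_subset_Ioi_self)

/-- The derivative of a bounded antitone function is integrable on `(0, ∞)`; the derivative may
fail to exist on a countable set. -/
theorem integrableOn_Ioi_deriv_of_nonpos_of_bounded {γ γ' : ℝ → ℝ} {s : Set ℝ} {K : ℝ}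
    (hs : s.Countable) (hcont : ContinuousOn γ (Ioi 0)) (hγ : ∀ r, 0 < r → 0 ≤ γ r)
    (hK : ∀ r, 0 < r → γ r ≤ K) (hneg : ∀ r, 0 < r → γ' r ≤ 0)
    (hderiv : ∀ r ∈ Ioi (0 : ℝ) \ s, HasDerivAt γ (γ' r) r)
    (hloc : ∀ a b, 0 < a → a ≤ b → IntegrableOn γ' (Ioc a b)) :
    IntegrableOn γ' (Ioi 0) := by
  -- The total variation of a monotone function telescopes to `γ a - γ b ≤ K`, uniformly in the
  -- interval.
  have hbound : ∀ a b, 0 < a → a ≤ b → ∫ r in a..b, ‖γ' r‖ ≤ K := by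
    intro a b ha hab
    have h1 : ∫ r in a..b, ‖γ' r‖ = -∫ r in a..b, γ' r := by
      rw [← intervalIntegral.integral_neg]
      refine intervalIntegral.integral_congr fun r hr => ?_
      rw [uIcc_of_le hab] at hr
      exact Real.norm_of_nonpos (hneg r (ha.trans_le hr.1))
    rw [h1, integral_eq_of_hasDerivAt_off_countable_of_le γ γ' hab hs
      (hcont.mono fun r hr => ha.trans_le hr.1)
      (fun r hr => hderiv r ⟨ha.trans hr.1.1, hr.2⟩)
      ((intervalIntegrable_iff_integrableOn_Ioc_of_le hab).2 (hloc a b ha hab))]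
    linarith [hγ b (ha.trans_le hab), hK a ha]
  have h0 : IntegrableOn γ' (Ioc 0 1) := by
    have hpos : ∀ k : ℕ, (0 : ℝ) < 1 / (k + 1) := fun k => by positivity
    have hle : ∀ k : ℕ, (1 : ℝ) / (k + 1) ≤ 1 := fun k => by
      rw [div_le_one (by positivity)]
      linarith [k.cast_nonneg (α := ℝ)]
    refine integrableOn_Ioc_of_intervalIntegral_norm_bounded_left (l := atTop) (I := K)
      (a := fun k : ℕ => (1 : ℝ) / (k + 1)) (fun k => hloc _ _ (hpos k) (hle k))
      tendsto_one_div_add_atTop_nhds_zero_nat (Eventually.of_forall fun k => ?_)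
    rw [← intervalIntegral.integral_of_le (hle k)]
    exact hbound _ _ (hpos k) (hle k)
  have h1 : IntegrableOn γ' (Ioi 1) := by
    refine integrableOn_Ioi_of_intervalIntegral_norm_bounded (l := atTop) (b := id) K 1
      (fun i => ?_) tendsto_id ?_
    · rcases le_total 1 i with h | h
      · exact hloc 1 i one_pos h
      · simp [Ioc_eq_empty_of_le h]
    · filter_upwards [eventually_ge_atTop 1] with b hb using hbound 1 b one_pos hb
  rw [← Ioc_union_Ioi_eq_Ioi zero_le_one]
  exact h0.union h1

theorem tendsto_pow_mul_exp_neg_sq (k : ℕ) (c : ℝ) :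
    Tendsto (fun r : ℝ => r ^ k * Real.exp (-r ^ 2 / 2 + r * c)) atTop (𝓝 0) := by
  have h := (Real.tendsto_pow_mul_exp_neg_atTop_nhds_zero k)
  refine squeeze_zero' ?_ ?_ h
  · filter_upwards [eventually_ge_atTop 0] with r hr
    positivity
  -- For `r ≥ 2(c + 1)` the exponent `-r²/2 + r c` is at most `-r`.
  · filter_upwards [eventually_ge_atTop 0, eventually_ge_atTop (2 * (c + 1))] with r hr hrc
    gcongr
    nlinarith

theorem integrableOn_pow_mul_exp_neg_sq (k : ℕ) (c : ℝ) :
    IntegrableOn (fun r : ℝ => r ^ k * Real.exp (-r ^ 2 / 2 + r * c)) (Ioi 0) := by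
  have h := (integrableOn_rpow_mul_exp_neg_mul_sq (b := 1 / 4) (by norm_num)
    (s := k) (by linarith [k.cast_nonneg (α := ℝ)])).const_mul (Real.exp (c ^ 2))
  refine h.mono' (by fun_prop) ?_
  filter_upwards [ae_restrict_mem measurableSet_Ioi] with r (hr : 0 < r)
  rw [Real.norm_of_nonneg (by positivity), Real.rpow_natCast, mul_left_comm, ← Real.exp_add]
  refine mul_le_mul_of_nonneg_left (Real.exp_le_exp.2 ?_) (by positivity)
  nlinarith [sq_nonneg (r / 2 - c)]

theorem exists_bound_pow_mul_exp_neg_sq (k : ℕ) (c : ℝ) :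
    ∃ B : ℝ, ∀ r, 0 < r → r ^ k * Real.exp (-r ^ 2 / 2 + r * c) ≤ B := by
  obtain ⟨T, hT⟩ := eventually_atTop.1
    ((tendsto_pow_mul_exp_neg_sq k c).eventually (eventually_le_nhds zero_lt_one))
  obtain ⟨B, hB⟩ := (isCompact_Icc (a := (0 : ℝ)) (b := T)).bddAbove_image
    (f := fun r : ℝ => r ^ k * Real.exp (-r ^ 2 / 2 + r * c)) (by fun_prop)
  refine ⟨max B 1, fun r hr => ?_⟩
  rcases le_total r T with h | h
  · exact (hB ⟨r, ⟨hr.le, h⟩, rfl⟩).trans (le_max_left _ _)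
  · exact (hT r h).trans (le_max_right _ _)

/-- Stein's identity along a ray: integration by parts against the weight
`r ^ (n + 2) * exp (-r ^ 2 / 2 + r * c)`. -/
theorem stein_identity_ray {γ γ' : ℝ → ℝ} {s : Set ℝ} {K : ℝ} (n : ℕ) (c : ℝ)
    (hs : s.Countable) (hcont : ContinuousOn γ (Ioi 0)) (hγ : ∀ r, 0 < r → 0 ≤ γ r)
    (hK : ∀ r, 0 < r → γ r ≤ K) (hderiv : ∀ r ∈ Ioi (0 : ℝ) \ s, HasDerivAt γ (γ' r) r)
    (hint : IntegrableOn γ' (Ioi 0)) :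
    (∀ k : ℕ, IntegrableOn (fun r => r ^ k * γ r * Real.exp (-r ^ 2 / 2 + r * c)) (Ioi 0)) ∧
    (∀ k : ℕ, IntegrableOn (fun r => r ^ k * γ' r * Real.exp (-r ^ 2 / 2 + r * c)) (Ioi 0)) ∧
    ∫ r in Ioi (0 : ℝ), ((n + 1) * (r ^ n * γ r * Real.exp (-r ^ 2 / 2 + r * c)) +
      r ^ (n + 1) * γ' r * Real.exp (-r ^ 2 / 2 + r * c) -
      r ^ (n + 1) * (r - c) * γ r * Real.exp (-r ^ 2 / 2 + r * c)) = 0 := by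
  have hmγ : AEStronglyMeasurable γ (volume.restrict (Ioi 0)) :=
    hcont.aestronglyMeasurable measurableSet_Ioi
  have hI : ∀ k : ℕ,
      IntegrableOn (fun r => r ^ k * γ r * Real.exp (-r ^ 2 / 2 + r * c)) (Ioi 0) := by
    intro k
    refine ((integrableOn_pow_mul_exp_neg_sq k c).const_mul K).mono' ?_ ?_
    · exact ((by fun_prop : AEStronglyMeasurable (fun r : ℝ => r ^ k) _).mul hmγ).mul (by fun_prop)
    · filter_upwards [ae_restrict_mem measurableSet_Ioi] with r (hr : 0 < r)
      have := hγ r hr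
      rw [Real.norm_of_nonneg (by positivity), mul_right_comm, mul_comm K]
      gcongr
      exact hK r hr
  have hI' : ∀ k : ℕ,
      IntegrableOn (fun r => r ^ k * γ' r * Real.exp (-r ^ 2 / 2 + r * c)) (Ioi 0) := by
    intro k
    obtain ⟨B, hB⟩ := exists_bound_pow_mul_exp_neg_sq k c
    have : IntegrableOn (fun r => (r ^ k * Real.exp (-r ^ 2 / 2 + r * c)) * γ' r) (Ioi 0) := by
      refine Integrable.bdd_mul (c := B) hint (by fun_prop) ?_
      filter_upwards [ae_restrict_mem measurableSet_Ioi] with r (hr : 0 < r)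
      rw [Real.norm_of_nonneg (by positivity)]
      exact hB r hr
    exact this.congr (ae_of_all _ fun r => by ring)
  refine ⟨hI, hI', ?_⟩
  set G : ℝ → ℝ := fun r => r ^ (n + 1) * γ r * Real.exp (-r ^ 2 / 2 + r * c) with hG
  have hGle : ∀ r, 0 < r → G r ≤ K * (r ^ (n + 1) * Real.exp (-r ^ 2 / 2 + r * c)) := by
    intro r hr
    calc G r = γ r * (r ^ (n + 1) * Real.exp (-r ^ 2 / 2 + r * c)) := by simp only [hG]; ring
      _ ≤ _ := mul_le_mul_of_nonneg_right (hK r hr) (by positivity)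
  refine integral_Ioi_deriv_eq_zero (G := G) hs ?_ (by simp [hG]) ?_ ?_ ?_
  · intro r hr
    -- Nothing is known about `γ` at `0`; the factor `r ^ (n + 1)` and the bound `K` make `G`
    -- continuous there.
    rcases eq_or_lt_of_le (show (0 : ℝ) ≤ r from hr) with rfl | hr
    · have hlim : Tendsto (fun r : ℝ => K * (r ^ (n + 1) * Real.exp (-r ^ 2 / 2 + r * c)))
          (𝓝[>] 0) (𝓝 0) := by
        have : Continuous fun r : ℝ => K * (r ^ (n + 1) * Real.exp (-r ^ 2 / 2 + r * c)) := by
          fun_prop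
        simpa using (this.tendsto 0).mono_left nhdsWithin_le_nhds
      rw [← continuousWithinAt_Ioi_iff_Ici, ContinuousWithinAt,
        show G 0 = 0 by simp [hG]]
      refine squeeze_zero' ?_ ?_ hlim
      · filter_upwards [self_mem_nhdsWithin] with r (hr : 0 < r)
        have := hγ r hr
        positivity
      · filter_upwards [self_mem_nhdsWithin] with r (hr : 0 < r)
        exact hGle r hr
    · have : ContinuousAt γ r := hcont.continuousAt (Ioi_mem_nhds hr)
      exact ContinuousAt.continuousWithinAt (by fun_prop)
  · have hlim := (tendsto_pow_mul_exp_neg_sq (n + 1) c).const_mul K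
    rw [mul_zero] at hlim
    refine squeeze_zero' ?_ ?_ hlim
    · filter_upwards [eventually_gt_atTop 0] with r hr
      have := hγ r hr
      positivity
    · filter_upwards [eventually_gt_atTop 0] with r hr
      exact hGle r hr
  · intro r hr
    have he : HasDerivAt (fun r : ℝ => Real.exp (-r ^ 2 / 2 + r * c))
        (Real.exp (-r ^ 2 / 2 + r * c) * (-r + c)) r := by
      have h1 : HasDerivAt (fun r : ℝ => -r ^ 2 / 2 + r * c) (-r + c) r := by
        have := (((hasDerivAt_id r).pow 2).neg.div_const 2).add ((hasDerivAt_id r).mul_const c)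
        refine this.congr_deriv ?_
        simp
        ring
      exact h1.exp
    have := (((hasDerivAt_id r).pow (n + 1)).mul (hderiv r hr)).mul he
    refine this.congr_deriv ?_
    simp
    ring
  · refine Integrable.sub (Integrable.add ((hI n).const_mul _) (hI' (n + 1))) ?_
    exact ((hI (n + 2)).sub ((hI (n + 1)).const_mul c)).congr (ae_of_all _ fun r => by
      simp only [Pi.sub_apply]; ring)

/-! ### The cumulative rate and the loss difference along a ray. -/

/-- The function `M(w) = ∫₀^w t⁻¹ Φ(t) dt + C`. -/
noncomputable def cumulativeRate (Φ : ℝ → ℝ) (C w : ℝ) : ℝ :=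
  (∫ t in (0 : ℝ)..w, t⁻¹ * Φ t) + C

namespace RateConditions

variable {Φ : ℝ → ℝ}

theorem continuousOn_cumulativeRate (hΦ : RateConditions Φ) (C : ℝ) :
    ContinuousOn (cumulativeRate Φ C) (Ioi 0) := by
  intro w (hw : 0 < w)
  have h := intervalIntegral.continuousOn_primitive_interval' (a := 0)
    (hΦ.integrable (w + 1) (by linarith)) left_mem_uIcc
  rw [uIcc_of_le (by linarith)] at h
  exact ((h.continuousAt (Icc_mem_nhds hw (by linarith))).add continuousAt_const).continuousWithinAt

theorem le_cumulativeRate (hΦ : RateConditions Φ) (C : ℝ) {w : ℝ} (hw : 0 < w) :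
    C ≤ cumulativeRate Φ C w := by
  refine le_add_of_nonneg_left (intervalIntegral.integral_nonneg hw.le fun t ht => ?_)
  rcases eq_or_lt_of_le ht.1 with rfl | h
  · simp
  · exact mul_nonneg (inv_nonneg.2 h.le) (hΦ.nonneg t h)

theorem aemeasurable (hΦ : RateConditions Φ) : AEMeasurable Φ (volume.restrict (Ioi 0)) :=
  aemeasurable_restrict_of_monotoneOn measurableSet_Ioi hΦ.monotone

theorem hasDerivAt_cumulativeRate (hΦ : RateConditions Φ) (C : ℝ) {w : ℝ} (hw : 0 < w)
    (hc : ContinuousAt Φ w) : HasDerivAt (cumulativeRate Φ C) (w⁻¹ * Φ w) w := by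
  refine (intervalIntegral.integral_hasDerivAt_right (hΦ.integrable w hw)
    ⟨Ioi 0, Ioi_mem_nhds hw, ?_⟩ ?_).add_const C
  · exact (measurable_inv.aemeasurable.mul hΦ.aemeasurable).aestronglyMeasurable
  · exact (continuousAt_inv₀ hw.ne').mul hc

/-- A monotone rate takes values below any positive level near the origin. -/
theorem exists_lt (hΦ : RateConditions Φ) {ε : ℝ} (hε : 0 < ε) : ∃ t, 0 < t ∧ Φ t < ε := by
  by_contra! h
  -- If `Φ ≥ ε` throughout, then `t⁻¹ ≤ ε⁻¹ t⁻¹ Φ(t)` would be integrable at `0`.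
  have h1 : IntervalIntegrable (fun t : ℝ => t⁻¹) volume 0 1 := by
    refine (hΦ.integrable 1 one_pos |>.const_mul ε⁻¹).mono_fun' (by fun_prop) ?_
    filter_upwards [ae_restrict_mem measurableSet_uIoc] with t ht
    rw [uIoc_of_le zero_le_one] at ht
    have ht0 := ht.1
    rw [Real.norm_of_nonneg (by positivity), mul_left_comm]
    refine le_mul_of_one_le_right (by positivity) ?_
    rw [inv_mul_eq_div, one_le_div hε]
    exact h t ht0
  simp [intervalIntegrable_inv_iff] at h1

/-- The countable set of radii `r > 0` at which `r ↦ Φ (r ^ 2)` fails to be continuous. -/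
theorem countable_discontinuities (hΦ : RateConditions Φ) :
    {r : ℝ | 0 < r ∧ ¬ ContinuousAt Φ (r ^ 2)}.Countable := by
  have h : {w ∈ Ioi (0 : ℝ) | ¬ ContinuousWithinAt Φ (Ioi 0) w}.Countable :=
    hΦ.monotone.countable_not_continuousWithinAt
  refine MapsTo.countable_of_injOn (f := fun r : ℝ => r ^ 2) ?_ ?_ h
  · rintro r ⟨hr, hc⟩
    have hr2 : r ^ 2 ∈ Ioi (0 : ℝ) := mem_Ioi.2 (pow_pos hr 2)
    exact ⟨hr2, fun hw => hc (hw.continuousAt (Ioi_mem_nhds hr2))⟩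
  · intro a ha b hb hab
    exact (pow_left_inj₀ (le_of_lt ha.1) (le_of_lt hb.1) two_ne_zero).1 hab

theorem comp_sq_le (hΦ : RateConditions Φ) {a b : ℝ} (ha : 0 < a) (hab : a ≤ b) :
    Φ (a ^ 2) ≤ Φ (b ^ 2) :=
  hΦ.monotone (mem_Ioi.2 (pow_pos ha 2)) (mem_Ioi.2 (pow_pos (ha.trans_le hab) 2))
    (pow_le_pow_left₀ ha.le hab 2)

theorem aemeasurable_comp_sq (hΦ : RateConditions Φ) :
    AEMeasurable (fun r => Φ (r ^ 2)) (volume.restrict (Ioi 0)) := by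
  refine aemeasurable_restrict_of_monotoneOn measurableSet_Ioi fun a ha b _ hab => ?_
  exact hΦ.comp_sq_le ha hab

/-- The loss difference of the two estimators along a ray, integrated by parts. -/
theorem integral_ray_eq (hΦ : RateConditions Φ) {C : ℝ} (hC : 0 < C) (n : ℕ) (c : ℝ) :
    IntegrableOn (fun r => r ^ n * (1 / cumulativeRate Φ C (r ^ 2)) ^ 2 * (1 - 4 * Φ (r ^ 2)) *
      Real.exp (-r ^ 2 / 2 + r * c)) (Ioi 0) ∧
    ∫ r in Ioi (0 : ℝ), (2 * r ^ (n + 1) * (r - c) * (1 / cumulativeRate Φ C (r ^ 2)) -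
        2 * (n + 1) * r ^ n * (1 / cumulativeRate Φ C (r ^ 2)) +
        r ^ n * (1 / cumulativeRate Φ C (r ^ 2)) ^ 2) * Real.exp (-r ^ 2 / 2 + r * c) =
      ∫ r in Ioi (0 : ℝ), r ^ n * (1 / cumulativeRate Φ C (r ^ 2)) ^ 2 * (1 - 4 * Φ (r ^ 2)) *
        Real.exp (-r ^ 2 / 2 + r * c) := by
  set γ : ℝ → ℝ := fun r => 1 / cumulativeRate Φ C (r ^ 2) with hγdef
  set γ' : ℝ → ℝ := fun r => -(2 * Φ (r ^ 2) / r * γ r ^ 2) with hγ'def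
  have hpos : ∀ r, 0 < r → 0 < cumulativeRate Φ C (r ^ 2) := fun r hr =>
    hC.trans_le (hΦ.le_cumulativeRate C (by positivity))
  have hγ : ∀ r, 0 < r → 0 ≤ γ r := fun r hr => (one_div_pos.2 (hpos r hr)).le
  have hK : ∀ r, 0 < r → γ r ≤ 1 / C := fun r hr =>
    one_div_le_one_div_of_le hC (hΦ.le_cumulativeRate C (by positivity))
  have hcont : ContinuousOn γ (Ioi 0) := by
    refine continuousOn_const.div ?_ fun r hr => (hpos r hr).ne'
    exact (hΦ.continuousOn_cumulativeRate C).comp (by fun_prop) fun r hr => mem_Ioi.2 (pow_pos hr 2)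
  have hneg : ∀ r, 0 < r → γ' r ≤ 0 := fun r hr => by
    have := hΦ.nonneg (r ^ 2) (by positivity)
    rw [hγ'def, Left.neg_nonpos_iff]
    positivity
  set s := {r : ℝ | 0 < r ∧ ¬ ContinuousAt Φ (r ^ 2)}
  have hderiv : ∀ r ∈ Ioi (0 : ℝ) \ s, HasDerivAt γ (γ' r) r := by
    rintro r ⟨hr : 0 < r, hrs⟩
    have hc : ContinuousAt Φ (r ^ 2) := by
      by_contra hc
      exact hrs ⟨hr, hc⟩
    have h1 := hΦ.hasDerivAt_cumulativeRate C (by positivity) hc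
    have h2 : HasDerivAt (fun r : ℝ => cumulativeRate Φ C (r ^ 2)) _ r :=
      h1.comp (h := fun r : ℝ => r ^ 2) r (hasDerivAt_pow 2 r)
    have h3 := h2.inv (hpos r hr).ne'
    simp only [← one_div] at h3
    refine h3.congr_deriv ?_
    simp only [hγ'def, hγdef]
    have := (hpos r hr).ne'
    field_simp
    simp
    ring
  have hmγ' : AEStronglyMeasurable γ' (volume.restrict (Ioi 0)) :=
    ((((hΦ.aemeasurable_comp_sq.const_mul 2).div aemeasurable_id).mul
      ((hcont.aemeasurable measurableSet_Ioi).pow_const 2)).neg).aestronglyMeasurable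
  have hloc : ∀ a b, 0 < a → a ≤ b → IntegrableOn γ' (Ioc a b) := by
    intro a b ha hab
    refine Integrable.mono' (g := fun _ => 2 * Φ (b ^ 2) / a * (1 / C) ^ 2)
      (integrableOn_const (by simp)) (hmγ'.mono_set fun r (hr : r ∈ Ioc a b) => ha.trans hr.1) ?_
    filter_upwards [ae_restrict_mem measurableSet_Ioc] with r hr
    have hr0 : 0 < r := ha.trans hr.1
    rw [Real.norm_of_nonpos (hneg r hr0), hγ'def, neg_neg]
    have h1 := hΦ.nonneg (r ^ 2) (by positivity)
    have h2 : Φ (r ^ 2) ≤ Φ (b ^ 2) := hΦ.comp_sq_le hr0 hr.2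
    have h3 := hK r hr0
    have h4 := hγ r hr0
    have h5 := hr.1.le
    have h6 := h1.trans h2
    gcongr
  have hint := integrableOn_Ioi_deriv_of_nonpos_of_bounded hΦ.countable_discontinuities hcont hγ hK
    hneg hderiv hloc
  obtain ⟨hI, hI', h0⟩ := stein_identity_ray n c hΦ.countable_discontinuities hcont hγ hK hderiv hint
  have hsq : IntegrableOn (fun r => r ^ n * γ r ^ 2 * Real.exp (-r ^ 2 / 2 + r * c)) (Ioi 0) := by
    have : IntegrableOn (fun r => γ r * (r ^ n * γ r * Real.exp (-r ^ 2 / 2 + r * c))) (Ioi 0) := by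
      refine Integrable.bdd_mul (c := 1 / C) (hI n) (hcont.aestronglyMeasurable measurableSet_Ioi) ?_
      filter_upwards [ae_restrict_mem measurableSet_Ioi] with r (hr : 0 < r)
      rw [Real.norm_of_nonneg (hγ r hr)]
      exact hK r hr
    exact this.congr (ae_of_all _ fun r => by ring)
  -- Here `2 r γ' = -4 Φ(r²) γ²` produces the factor `1 - 4Φ`.
  have hk : EqOn (fun r => r ^ n * γ r ^ 2 * Real.exp (-r ^ 2 / 2 + r * c) +
      2 * (r ^ (n + 1) * γ' r * Real.exp (-r ^ 2 / 2 + r * c)))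
      (fun r => r ^ n * γ r ^ 2 * (1 - 4 * Φ (r ^ 2)) * Real.exp (-r ^ 2 / 2 + r * c)) (Ioi 0) := by
    intro r (hr : 0 < r)
    simp only [hγ'def]
    field_simp
    ring
  have hkint := hsq.add ((hI' (n + 1)).const_mul 2)
  refine ⟨hkint.congr_fun hk measurableSet_Ioi, ?_⟩
  rw [← setIntegral_congr_fun measurableSet_Ioi hk]
  have hS : IntegrableOn (fun r => (n + 1) * (r ^ n * γ r * Real.exp (-r ^ 2 / 2 + r * c)) +
      r ^ (n + 1) * γ' r * Real.exp (-r ^ 2 / 2 + r * c) -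
      r ^ (n + 1) * (r - c) * γ r * Real.exp (-r ^ 2 / 2 + r * c)) (Ioi 0) := by
    refine Integrable.sub (Integrable.add ((hI n).const_mul _) (hI' (n + 1))) ?_
    exact ((hI (n + 2)).sub ((hI (n + 1)).const_mul c)).congr (ae_of_all _ fun r => by
      simp only [Pi.sub_apply]; ring)
  -- The loss difference is this kernel minus twice the integrand of Stein's identity, whose
  -- integral is zero.
  have hsub := integral_sub hkint (hS.const_mul 2)
  rw [integral_const_mul, h0, mul_zero, sub_zero] at hsub
  refine Eq.trans ?_ hsub
  refine integral_congr_ae (ae_of_all _ fun r => ?_)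
  simp only [Pi.add_apply]
  ring

end RateConditions

/-! ### The sign-change argument. -/

/-- A function with a single sign change from positive to negative and non-positive integral has
non-positive integral against `cosh`. -/
theorem integral_mul_cosh_nonpos {h : ℝ → ℝ} {r₀ c : ℝ} (hr₀ : 0 < r₀)
    (hpos : ∀ r, 0 < r → r < r₀ → 0 ≤ h r) (hneg : ∀ r, r₀ < r → h r ≤ 0)
    (hint : IntegrableOn h (Ioi 0)) (hintc : IntegrableOn (fun r => h r * Real.cosh (r * c)) (Ioi 0))
    (h0 : ∫ r in Ioi (0 : ℝ), h r ≤ 0) :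
    ∫ r in Ioi (0 : ℝ), h r * Real.cosh (r * c) ≤ 0 ∧
      (c ≠ 0 → ∀ δ, 0 < δ → (∀ r, 0 < r → r < δ → 0 < h r) →
        ∫ r in Ioi (0 : ℝ), h r * Real.cosh (r * c) < 0) := by
  -- Subtracting the value of `cosh` at the sign change makes the two factors have opposite signs on
  -- both sides of `r₀`.
  have hle : ∀ r, 0 < r → h r * (Real.cosh (r * c) - Real.cosh (r₀ * c)) ≤ 0 := by
    intro r hr
    rcases lt_trichotomy r r₀ with hlt | rfl | hlt
    · refine mul_nonpos_of_nonneg_of_nonpos (hpos r hr hlt) (sub_nonpos.2 ?_)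
      rw [Real.cosh_le_cosh, abs_mul, abs_mul, abs_of_pos hr, abs_of_pos hr₀]
      gcongr
    · simp
    · refine mul_nonpos_of_nonpos_of_nonneg (hneg r hlt) (sub_nonneg.2 ?_)
      rw [Real.cosh_le_cosh, abs_mul, abs_mul, abs_of_pos hr, abs_of_pos hr₀]
      gcongr
  have hD : IntegrableOn (fun r => h r * (Real.cosh (r * c) - Real.cosh (r₀ * c))) (Ioi 0) :=
    (hintc.sub (hint.mul_const (Real.cosh (r₀ * c)))).congr
      (ae_of_all _ fun r => by simp only [Pi.sub_apply]; ring)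
  have hsplit : ∫ r in Ioi (0 : ℝ), h r * Real.cosh (r * c) =
      (∫ r in Ioi (0 : ℝ), h r * (Real.cosh (r * c) - Real.cosh (r₀ * c))) +
        (∫ r in Ioi (0 : ℝ), h r) * Real.cosh (r₀ * c) := by
    rw [← integral_mul_const, ← integral_add hD (hint.mul_const _)]
    exact integral_congr_ae (ae_of_all _ fun r => by ring)
  have h2 : (∫ r in Ioi (0 : ℝ), h r) * Real.cosh (r₀ * c) ≤ 0 :=
    mul_nonpos_of_nonpos_of_nonneg h0 (Real.cosh_pos _).le
  have h1 : ∫ r in Ioi (0 : ℝ), h r * (Real.cosh (r * c) - Real.cosh (r₀ * c)) ≤ 0 :=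
    setIntegral_nonpos measurableSet_Ioi hle
  refine ⟨by linarith, fun hc δ hδ hδpos => ?_⟩
  have h3 : 0 < ∫ r in Ioi (0 : ℝ), -(h r * (Real.cosh (r * c) - Real.cosh (r₀ * c))) := by
    rw [setIntegral_pos_iff_support_of_nonneg_ae]
    · refine lt_of_lt_of_le ?_ (measure_mono (s := Ioo 0 (min δ r₀)) ?_)
      · simp [hδ, hr₀]
      · intro r hr
        have hrδ := hr.2.trans_le (min_le_left _ _)
        have hrr := hr.2.trans_le (min_le_right _ _)
        refine ⟨?_, hr.1⟩
        rw [Function.mem_support]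
        refine neg_ne_zero.2 (mul_ne_zero (hδpos r hr.1 hrδ).ne' (sub_ne_zero.2 (ne_of_lt ?_)))
        rw [Real.cosh_lt_cosh, abs_mul, abs_mul, abs_of_pos hr.1, abs_of_pos hr₀]
        exact mul_lt_mul_of_pos_right hrr (abs_pos.2 hc)
    · filter_upwards [ae_restrict_mem measurableSet_Ioi] with r hr
      exact neg_nonneg.2 (hle r hr)
    · exact hD.neg
  rw [integral_neg] at h3
  linarith

/-- The loss difference integrated along a ray, in symmetrized form, is non-positive in every
direction as soon as it is at the origin. -/
theorem RateConditions.integral_ray_nonpos {Φ : ℝ → ℝ} (hΦ : RateConditions Φ) {C : ℝ} (hC : 0 < C)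
    (n : ℕ) {I : ℝ → ℝ} (hI : ∀ c, I c = ∫ r in Ioi (0 : ℝ), r ^ n *
      (1 / cumulativeRate Φ C (r ^ 2)) ^ 2 * (1 - 4 * Φ (r ^ 2)) * Real.exp (-r ^ 2 / 2 + r * c))
    (h0 : I 0 ≤ 0) (c : ℝ) : I c + I (-c) ≤ 0 ∧ (c ≠ 0 → I c + I (-c) < 0) := by
  set h : ℝ → ℝ := fun r => r ^ n * (1 / cumulativeRate Φ C (r ^ 2)) ^ 2 * (1 - 4 * Φ (r ^ 2)) *
    Real.exp (-r ^ 2 / 2 + r * 0) with hdef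
  have hcosh : ∀ r, r ^ n * (1 / cumulativeRate Φ C (r ^ 2)) ^ 2 * (1 - 4 * Φ (r ^ 2)) *
      Real.exp (-r ^ 2 / 2 + r * c) + r ^ n * (1 / cumulativeRate Φ C (r ^ 2)) ^ 2 *
      (1 - 4 * Φ (r ^ 2)) * Real.exp (-r ^ 2 / 2 + r * -c) = 2 * (h r * Real.cosh (r * c)) := by
    intro r
    simp only [hdef, Real.cosh_eq, mul_zero, add_zero, Real.exp_add, mul_neg]
    ring
  have hint := (hΦ.integral_ray_eq hC n c).1.add (hΦ.integral_ray_eq hC n (-c)).1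
  have hintc : IntegrableOn (fun r => h r * Real.cosh (r * c)) (Ioi 0) :=
    (hint.const_mul (1 / 2)).congr (ae_of_all _ fun r => by
      simp only [Pi.add_apply, hcosh]; ring)
  have hsum : I c + I (-c) = 2 * ∫ r in Ioi (0 : ℝ), h r * Real.cosh (r * c) := by
    rw [hI, hI, ← integral_add (hΦ.integral_ray_eq hC n c).1 (hΦ.integral_ray_eq hC n (-c)).1,
      ← integral_const_mul]
    exact integral_congr_ae (ae_of_all _ hcosh)
  rw [hI] at h0
  have hw : ∀ r, 0 < r → 0 < r ^ n * (1 / cumulativeRate Φ C (r ^ 2)) ^ 2 := fun r hr => by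
    have := hC.trans_le (hΦ.le_cumulativeRate C (w := r ^ 2) (by positivity))
    positivity
  -- The level `1/4` is where `1 - 4Φ` changes sign.
  obtain ⟨t, ht, htΦ⟩ := hΦ.exists_lt (ε := 1 / 4) (by norm_num)
  have hδ : ∀ r, 0 < r → r < √t → 0 < h r := by
    intro r hr hrt
    have := hΦ.monotone (mem_Ioi.2 (pow_pos hr 2)) ht ((Real.le_sqrt hr.le ht.le).1 hrt.le)
    exact mul_pos (mul_pos (hw r hr) (by linarith)) (Real.exp_pos _)
  -- Otherwise `Φ ≤ 1/4` everywhere, so `h ≥ 0` with `h > 0` near `0`, contradicting the hypothesis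
  -- at the origin.
  have hbdd : BddAbove {r : ℝ | 0 < r ∧ 4 * Φ (r ^ 2) ≤ 1} := by
    by_contra hnb
    have hnn : ∀ r, 0 < r → 0 ≤ h r := by
      intro r hr
      obtain ⟨r', ⟨hr', hr'Φ⟩, hrr'⟩ := not_bddAbove_iff.1 hnb r
      have := hΦ.comp_sq_le hr hrr'.le
      exact mul_nonneg (mul_nonneg (hw r hr).le (by linarith)) (Real.exp_pos _).le
    have : 0 < ∫ r in Ioi (0 : ℝ), h r := by
      rw [setIntegral_pos_iff_support_of_nonneg_ae]
      · refine lt_of_lt_of_le ?_ (measure_mono (s := Ioo 0 (√t)) fun r hr =>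
          ⟨(hδ r hr.1 hr.2).ne', hr.1⟩)
        simp [ht]
      · filter_upwards [ae_restrict_mem measurableSet_Ioi] with r hr using hnn r hr
      · exact (hΦ.integral_ray_eq hC n 0).1
    linarith
  have hmem : √t / 2 ∈ {r : ℝ | 0 < r ∧ 4 * Φ (r ^ 2) ≤ 1} := by
    have h1 : 0 < √t := Real.sqrt_pos.2 ht
    have h2 : (√t / 2) ^ 2 ≤ t := by
      rw [div_pow, Real.sq_sqrt ht.le]
      linarith
    have := hΦ.monotone (a := (√t / 2) ^ 2) (mem_Ioi.2 (by positivity)) ht h2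
    exact ⟨by positivity, by linarith⟩
  -- `Φ` may jump across `1/4`, so the sign change is located by a supremum rather than by a root.
  have hr₀ : 0 < sSup {r : ℝ | 0 < r ∧ 4 * Φ (r ^ 2) ≤ 1} := hmem.1.trans_le (le_csSup hbdd hmem)
  obtain ⟨h1, h2⟩ := integral_mul_cosh_nonpos (c := c) hr₀ (h := h) (fun r hr hlt => by
      obtain ⟨r', ⟨hr', hr'Φ⟩, hrr'⟩ := exists_lt_of_lt_csSup ⟨_, hmem⟩ hlt
      have := hΦ.comp_sq_le hr hrr'.le
      exact mul_nonneg (mul_nonneg (hw r hr).le (by linarith)) (Real.exp_pos _).le)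
    (fun r hlt => by
      have hr := hr₀.trans hlt
      have : 1 < 4 * Φ (r ^ 2) := by
        by_contra! hle
        exact hlt.not_ge (le_csSup hbdd ⟨hr, hle⟩)
      exact mul_nonpos_of_nonpos_of_nonneg
        (mul_nonpos_of_nonneg_of_nonpos (hw r hr).le (by linarith)) (Real.exp_pos _).le)
    (hΦ.integral_ray_eq hC n 0).1 hintc h0
  refine ⟨by linarith, fun hc => ?_⟩
  have := h2 hc _ (Real.sqrt_pos.2 ht) hδ
  linarith

/-! ### Risks as real integrals. -/

/-- Majorant for the losses. The singularity `‖x‖⁻²` is integrable because the dimension is at least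
three: the polar weight `r ^ (n + 2)` absorbs it. -/
theorem integrable_quadratic_mul_exp (n : ℕ) (a b d : ℝ) :
    Integrable (fun x : EuclideanSpace ℝ (Fin (n + 3)) =>
      (a + b * ‖x‖ ^ 2 + d / ‖x‖ ^ 2) * Real.exp (-(1 / 4) * ‖x‖ ^ 2)) := by
  refine (integrable_fun_norm_addHaar (f := fun y : ℝ =>
    (a + b * y ^ 2 + d / y ^ 2) * Real.exp (-(1 / 4) * y ^ 2)) volume).2 ?_
  have h : ∀ k : ℕ, IntegrableOn (fun y : ℝ => y ^ k * Real.exp (-(1 / 4) * y ^ 2)) (Ioi 0) := by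
    intro k
    have := integrableOn_rpow_mul_exp_neg_mul_sq (b := 1 / 4) (by norm_num)
      (s := k) (by linarith [k.cast_nonneg (α := ℝ)])
    simpa only [Real.rpow_natCast] using this
  refine IntegrableOn.congr_fun ((((h (n + 2)).const_mul a).add ((h (n + 4)).const_mul b)).add
    ((h n).const_mul d)) ?_ measurableSet_Ioi
  intro y (hy : 0 < y)
  simp only [finrank_euclideanSpace_fin, Pi.add_apply, smul_eq_mul,
    show n + 3 - 1 = n + 2 from rfl]
  field_simp
  ring

theorem measurable_shrinkageEstimator {p : ℕ} {φ : ℝ → ℝ} (hφ : Measurable φ) :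
    Measurable (shrinkageEstimator p φ) := by
  unfold shrinkageEstimator
  fun_prop

theorem integrable_loss {n : ℕ} {φ : ℝ → ℝ} {K : ℝ} (hφ : Measurable φ) (hK : ∀ w, |φ w| ≤ K)
    (θ : EuclideanSpace ℝ (Fin (n + 3))) :
    Integrable (fun x => ‖shrinkageEstimator (n + 3) φ x - θ‖ ^ 2 *
      Real.exp (-‖x - θ‖ ^ 2 / 2)) := by
  -- The threes come from `(a + b + c)² ≤ 3(a² + b² + c²)`; the exponents from `‖x‖² ≤ 2‖x - θ‖² +
  -- 2‖θ‖²`.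
  refine ((integrable_quadratic_mul_exp n (3 * ‖θ‖ ^ 2) 3 (3 * K ^ 2)).const_mul
    (Real.exp (‖θ‖ ^ 2 / 2))).mono' ?_ (ae_of_all _ fun x => ?_)
  · have := measurable_shrinkageEstimator (p := n + 3) hφ
    exact Measurable.aestronglyMeasurable (by fun_prop)
  · rw [Real.norm_of_nonneg (by positivity), mul_left_comm, ← Real.exp_add]
    have h1 : ‖shrinkageEstimator (n + 3) φ x - θ‖ ≤ ‖x‖ + K / ‖x‖ + ‖θ‖ := by
      have h2 : ‖(φ (‖x‖ ^ 2) / ‖x‖ ^ 2) • x‖ ≤ K / ‖x‖ := by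
        rw [norm_smul, norm_div, Real.norm_eq_abs, Real.norm_of_nonneg (by positivity)]
        rcases eq_or_ne ‖x‖ 0 with h | h
        · simp [h]
        · rw [div_mul_eq_mul_div, sq, mul_div_mul_right _ _ h]
          gcongr
          exact hK _
      rw [shrinkageEstimator, sub_smul, one_smul]
      have h3 := norm_sub_le (x - (φ (‖x‖ ^ 2) / ‖x‖ ^ 2) • x) θ
      have h4 := norm_sub_le x ((φ (‖x‖ ^ 2) / ‖x‖ ^ 2) • x)
      linarith
    have h2 : ‖shrinkageEstimator (n + 3) φ x - θ‖ ^ 2 ≤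
        3 * ‖θ‖ ^ 2 + 3 * ‖x‖ ^ 2 + 3 * K ^ 2 / ‖x‖ ^ 2 := by
      refine (pow_le_pow_left₀ (norm_nonneg _) h1 2).trans ?_
      rw [mul_div_assoc, ← div_pow]
      nlinarith [sq_nonneg (‖x‖ - K / ‖x‖), sq_nonneg (‖x‖ - ‖θ‖), sq_nonneg (K / ‖x‖ - ‖θ‖)]
    refine mul_le_mul h2 (Real.exp_le_exp.2 ?_) (Real.exp_pos _).le ((sq_nonneg _).trans h2)
    have h5 : ‖x‖ ≤ ‖x - θ‖ + ‖θ‖ := by simpa using norm_add_le (x - θ) θ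
    nlinarith [sq_nonneg (‖x - θ‖ - ‖θ‖), norm_nonneg x,
      pow_le_pow_left₀ (norm_nonneg x) h5 2]

theorem risk_eq_ofReal {n : ℕ} {φ : ℝ → ℝ} {K : ℝ} (hφ : Measurable φ) (hK : ∀ w, |φ w| ≤ K)
    (θ : EuclideanSpace ℝ (Fin (n + 3))) :
    risk (shrinkageEstimator (n + 3) φ) θ = ENNReal.ofReal ((√(2 * Real.pi))⁻¹ ^ (n + 3) *
      ∫ x, ‖shrinkageEstimator (n + 3) φ x - θ‖ ^ 2 * Real.exp (-‖x - θ‖ ^ 2 / 2)) := by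
  have hm := measurable_shrinkageEstimator (p := n + 3) hφ
  rw [risk, multivariateGaussian_one_eq_withDensity,
    lintegral_withDensity_eq_lintegral_mul _ (by fun_prop) (by fun_prop), ← integral_const_mul,
    ofReal_integral_eq_lintegral_ofReal ((integrable_loss hφ hK θ).const_mul _)
      (ae_of_all _ fun x => by positivity)]
  refine lintegral_congr fun x => ?_
  rw [Pi.mul_apply, ← ofReal_norm, ← ENNReal.ofReal_pow (norm_nonneg _),
    ← ENNReal.ofReal_mul (by positivity)]
  congr 1
  ring

theorem jamesStein_eq_shrinkageEstimator (p : ℕ) :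
    jamesStein p = shrinkageEstimator p fun _ => (p : ℝ) - 2 := rfl

/-- The difference of the losses of `shrinkageEstimator p φ` and `jamesStein p`, weighted by the
unnormalized Gaussian density. -/
noncomputable def lossDiff (p : ℕ) (φ : ℝ → ℝ) (θ x : EuclideanSpace ℝ (Fin p)) : ℝ :=
  (‖shrinkageEstimator p φ x - θ‖ ^ 2 - ‖jamesStein p x - θ‖ ^ 2) * Real.exp (-‖x - θ‖ ^ 2 / 2)

theorem integrable_lossDiff
    {n : ℕ} {φ : ℝ → ℝ} {K : ℝ} (hφ : Measurable φ) (hK : ∀ w, |φ w| ≤ K)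
    (θ : EuclideanSpace ℝ (Fin (n + 3))) :
    Integrable (lossDiff (n + 3) φ θ) := by
  refine ((integrable_loss hφ hK θ).sub (integrable_loss measurable_const
    (fun _ => le_rfl) θ (φ := fun _ => ((n + 3 : ℕ) : ℝ) - 2))).congr (ae_of_all _ fun x => ?_)
  simp only [Pi.sub_apply, lossDiff, jamesStein_eq_shrinkageEstimator]
  ring

/-- Both risks are finite, so comparing them in `ℝ≥0∞` amounts to the sign of one real integral. The
two non-negativity claims are needed because `ENNReal.ofReal` truncates at zero. -/
theorem risk_shrinkageEstimator_eq_jamesStein_add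
    {n : ℕ} {φ : ℝ → ℝ} {K : ℝ} (hφ : Measurable φ) (hK : ∀ w, |φ w| ≤ K)
    (θ : EuclideanSpace ℝ (Fin (n + 3))) :
    ∃ b : ℝ, 0 ≤ b ∧
      0 ≤ b + (√(2 * Real.pi))⁻¹ ^ (n + 3) * ∫ x, lossDiff (n + 3) φ θ x ∧
      risk (jamesStein (n + 3)) θ = ENNReal.ofReal b ∧
      risk (shrinkageEstimator (n + 3) φ) θ =
        ENNReal.ofReal (b + (√(2 * Real.pi))⁻¹ ^ (n + 3) * ∫ x, lossDiff (n + 3) φ θ x) := by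
  have hJ := integrable_loss measurable_const
    (fun _ => le_rfl) θ (φ := fun _ => ((n + 3 : ℕ) : ℝ) - 2)
  have hadd : (∫ x, ‖jamesStein (n + 3) x - θ‖ ^ 2 * Real.exp (-‖x - θ‖ ^ 2 / 2)) +
      ∫ x, lossDiff (n + 3) φ θ x =
      ∫ x, ‖shrinkageEstimator (n + 3) φ x - θ‖ ^ 2 * Real.exp (-‖x - θ‖ ^ 2 / 2) := by
    rw [jamesStein_eq_shrinkageEstimator, ← integral_add hJ (integrable_lossDiff hφ hK θ)]
    refine integral_congr_ae (ae_of_all _ fun x => ?_)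
    simp only [lossDiff, jamesStein_eq_shrinkageEstimator]
    ring
  refine ⟨(√(2 * Real.pi))⁻¹ ^ (n + 3) *
    ∫ x, ‖jamesStein (n + 3) x - θ‖ ^ 2 * Real.exp (-‖x - θ‖ ^ 2 / 2), ?_, ?_, ?_, ?_⟩
  · exact mul_nonneg (by positivity) (integral_nonneg fun x => by positivity)
  · rw [← mul_add, hadd]
    exact mul_nonneg (by positivity) (integral_nonneg fun x => by positivity)
  · exact risk_eq_ofReal measurable_const (fun _ => le_rfl) θ
  · rw [← mul_add, hadd, risk_eq_ofReal hφ hK]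

theorem risk_le_iff_integral_lossDiff
    {n : ℕ} {φ : ℝ → ℝ} {K : ℝ} (hφ : Measurable φ) (hK : ∀ w, |φ w| ≤ K)
    (θ : EuclideanSpace ℝ (Fin (n + 3))) :
    risk (shrinkageEstimator (n + 3) φ) θ ≤ risk (jamesStein (n + 3)) θ ↔
      ∫ x, lossDiff (n + 3) φ θ x ≤ 0 := by
  obtain ⟨b, hb, -, h1, h2⟩ := risk_shrinkageEstimator_eq_jamesStein_add hφ hK θ
  have hc : 0 < (√(2 * Real.pi))⁻¹ ^ (n + 3) := by positivity
  rw [h1, h2, ENNReal.ofReal_le_ofReal_iff hb, add_le_iff_nonpos_right]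
  refine ⟨fun h => ?_, fun h => mul_nonpos_of_nonneg_of_nonpos hc.le h⟩
  by_contra! h'
  exact h.not_gt (mul_pos hc h')

theorem risk_lt_iff_integral_lossDiff
    {n : ℕ} {φ : ℝ → ℝ} {K : ℝ} (hφ : Measurable φ) (hK : ∀ w, |φ w| ≤ K)
    (θ : EuclideanSpace ℝ (Fin (n + 3))) :
    risk (shrinkageEstimator (n + 3) φ) θ < risk (jamesStein (n + 3)) θ ↔
      ∫ x, lossDiff (n + 3) φ θ x < 0 := by
  obtain ⟨b, hb, hb', h1, h2⟩ := risk_shrinkageEstimator_eq_jamesStein_add hφ hK θ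
  have hc : 0 < (√(2 * Real.pi))⁻¹ ^ (n + 3) := by positivity
  rw [h1, h2, ENNReal.ofReal_lt_ofReal_iff_of_nonneg hb', add_lt_iff_neg_left]
  refine ⟨fun h => ?_, fun h => mul_neg_of_pos_of_neg hc h⟩
  by_contra! h'
  exact h.not_ge (mul_nonneg hc.le h')

theorem shrinkageEstimator_neg (p : ℕ) (φ : ℝ → ℝ) (x : EuclideanSpace ℝ (Fin p)) :
    shrinkageEstimator p φ (-x) = -shrinkageEstimator p φ x := by
  simp [shrinkageEstimator]

/-- Both estimators are odd and Lebesgue measure is reflection invariant. This permits averaging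
over `θ` and `-θ`. -/
theorem integral_lossDiff_neg (p : ℕ) (φ : ℝ → ℝ) (θ : EuclideanSpace ℝ (Fin p)) :
    ∫ x, lossDiff p φ (-θ) x = ∫ x, lossDiff p φ θ x := by
  rw [← integral_neg_eq_self]
  refine integral_congr_ae (ae_of_all _ fun x => ?_)
  have h : ∀ y : EuclideanSpace ℝ (Fin p), ‖-y - -θ‖ = ‖y - θ‖ := fun y => by
    rw [← neg_sub', norm_neg]
  simp only [lossDiff, jamesStein_eq_shrinkageEstimator, shrinkageEstimator_neg, h]

/-- Outside `(0, ∞)` only `φ 0` could matter, and it multiplies the zero vector. -/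
theorem shrinkageEstimator_congr {p : ℕ} {φ ψ : ℝ → ℝ} (h : EqOn φ ψ (Ioi 0)) :
    shrinkageEstimator p φ = shrinkageEstimator p ψ := by
  ext1 x
  rcases eq_or_ne x 0 with rfl | hx
  · simp [shrinkageEstimator]
  · rw [shrinkageEstimator, shrinkageEstimator, h (mem_Ioi.2 (by positivity))]

/-- The difference of losses along the ray spanned by the unit vector `u`. -/
theorem lossDiff_smul {n : ℕ} {φ : ℝ → ℝ} (θ : EuclideanSpace ℝ (Fin (n + 3)))
    {u : EuclideanSpace ℝ (Fin (n + 3))} (hu : ‖u‖ = 1) {r g : ℝ} (hr : 0 < r)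
    (hg : φ (r ^ 2) = n + 1 - g) :
    r ^ (n + 2) * lossDiff (n + 3) φ θ (r • u) = Real.exp (-‖θ‖ ^ 2 / 2) *
      ((2 * r ^ (n + 1) * (r - inner ℝ θ u) * g - 2 * (n + 1) * r ^ n * g + r ^ n * g ^ 2) *
        Real.exp (-r ^ 2 / 2 + r * inner ℝ θ u)) := by
  have hn : ‖r • u‖ = r := by rw [norm_smul, hu, mul_one, Real.norm_of_nonneg hr.le]
  have hsq : ∀ a : ℝ, ‖(a * r) • u - θ‖ ^ 2 =
      (a * r) ^ 2 - 2 * (a * r) * inner ℝ θ u + ‖θ‖ ^ 2 := fun a => by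
    rw [norm_sub_sq_real, norm_smul, hu, mul_one, Real.norm_eq_abs, sq_abs, real_inner_smul_left,
      real_inner_comm]
    ring
  have hexp : Real.exp (-‖r • u - θ‖ ^ 2 / 2) =
      Real.exp (-‖θ‖ ^ 2 / 2) * Real.exp (-r ^ 2 / 2 + r * inner ℝ θ u) := by
    have := hsq 1
    rw [one_mul] at this
    rw [this, ← Real.exp_add]
    congr 1
    ring
  rw [lossDiff, hexp, jamesStein_eq_shrinkageEstimator, shrinkageEstimator, shrinkageEstimator, hn,
    smul_smul, smul_smul, hsq, hsq, hg]
  push_cast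
  field_simp
  ring

theorem shrinkageOfRate_eq (Φ : ℝ → ℝ) (p : ℕ) (C w : ℝ) :
    shrinkageOfRate p Φ C w = (p : ℝ) - 2 - 1 / cumulativeRate Φ C w := rfl

/-! ### Dominance. -/

/-- A shrinkage estimator of the given form dominates the James–Stein estimator as soon as its risk
at the origin is not larger. -/
theorem RateConditions.dominates {Φ : ℝ → ℝ} (hΦ : RateConditions Φ) {p : ℕ} (hp : 3 ≤ p) {C : ℝ}
    (hC : 0 < C)
    (h0 : risk (shrinkageEstimator p (shrinkageOfRate p Φ C)) 0 ≤ risk (jamesStein p) 0) :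
    Dominates (shrinkageEstimator p (shrinkageOfRate p Φ C)) (jamesStein p) := by
  obtain ⟨n, rfl⟩ := Nat.exists_eq_add_of_le' hp
  -- Cutting off to `(0, ∞)` makes `φ` measurable and bounded on the whole line without changing the
  -- estimator.
  set φ : ℝ → ℝ := (Ioi 0).indicator (shrinkageOfRate (n + 3) Φ C) with hφdef
  have hpos : ∀ w, 0 < w → 0 < cumulativeRate Φ C w := fun w hw =>
    hC.trans_le (hΦ.le_cumulativeRate C hw)
  have hφm : Measurable φ := by
    have : ContinuousOn (shrinkageOfRate (n + 3) Φ C) (Ioi 0) :=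
      continuousOn_const.sub (continuousOn_const.div (hΦ.continuousOn_cumulativeRate C)
        fun w hw => (hpos w hw).ne')
    classical
    rw [hφdef, ← piecewise_eq_indicator]
    exact this.measurable_piecewise continuousOn_const measurableSet_Ioi
  have hK : ∀ w, |φ w| ≤ (n + 1) + 1 / C := by
    intro w
    by_cases hw : 0 < w
    · rw [hφdef, indicator_of_mem (mem_Ioi.2 hw), shrinkageOfRate_eq]
      have h1 := one_div_pos.2 (hpos w hw)
      have h2 := one_div_le_one_div_of_le hC (hΦ.le_cumulativeRate C hw)
      have h3 : (0 : ℝ) ≤ n := n.cast_nonneg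
      push_cast
      rw [abs_le]
      constructor <;> linarith
    · rw [hφdef, indicator_of_notMem (by simpa using hw), abs_zero]
      positivity
  rw [shrinkageEstimator_congr (ψ := φ) fun w hw => (indicator_of_mem hw _).symm] at h0 ⊢
  set I : ℝ → ℝ := fun c => ∫ r in Ioi (0 : ℝ), r ^ n *
    (1 / cumulativeRate Φ C (r ^ 2)) ^ 2 * (1 - 4 * Φ (r ^ 2)) * Real.exp (-r ^ 2 / 2 + r * c)
    with hI
  set σ := (volume : Measure (EuclideanSpace ℝ (Fin (n + 3)))).toSphere
  have hpolar : ∀ θ : EuclideanSpace ℝ (Fin (n + 3)),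
      Integrable (fun u : Metric.sphere (0 : EuclideanSpace ℝ (Fin (n + 3))) 1 =>
        Real.exp (-‖θ‖ ^ 2 / 2) * I (inner ℝ θ u)) σ ∧
      ∫ x, lossDiff (n + 3) φ θ x = ∫ u : Metric.sphere (0 : EuclideanSpace ℝ (Fin (n + 3))) 1,
        Real.exp (-‖θ‖ ^ 2 / 2) * I (inner ℝ θ u) ∂σ := by
    intro θ
    have h := integral_polar volume (integrable_lossDiff hφm hK θ)
    have hray : ∀ u : Metric.sphere (0 : EuclideanSpace ℝ (Fin (n + 3))) 1,
        ∫ r in Ioi (0 : ℝ), r ^ (Module.finrank ℝ (EuclideanSpace ℝ (Fin (n + 3))) - 1) *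
          lossDiff (n + 3) φ θ (r • (u : EuclideanSpace ℝ (Fin (n + 3)))) =
        Real.exp (-‖θ‖ ^ 2 / 2) * I (inner ℝ θ u) := by
      intro u
      simp only [hI]
      rw [← (hΦ.integral_ray_eq hC n (inner ℝ θ (u : EuclideanSpace ℝ (Fin (n + 3))))).2,
        ← integral_const_mul, finrank_euclideanSpace_fin]
      refine setIntegral_congr_fun measurableSet_Ioi fun r (hr : 0 < r) => ?_
      refine lossDiff_smul θ (norm_eq_of_mem_sphere u) hr ?_
      rw [hφdef, indicator_of_mem (mem_Ioi.2 (by positivity)), shrinkageOfRate_eq]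
      push_cast
      ring
    simpa only [hray] using h
  -- At `θ = 0` every ray contributes the same value `I 0`, and the sphere has positive mass.
  have hI0 : I 0 ≤ 0 := by
    rw [risk_le_iff_integral_lossDiff hφm hK, (hpolar 0).2] at h0
    simp only [inner_zero_left, integral_const] at h0
    have hσ : 0 < σ.real univ := by
      rw [measureReal_def]
      exact ENNReal.toReal_pos (Measure.measure_univ_ne_zero.2 (Measure.toSphere_ne_zero _))
        (measure_ne_top _ _)
    by_contra! hlt
    refine absurd h0 (not_le.2 ?_)
    rw [smul_eq_mul]
    positivity
  have hsym : ∀ θ : EuclideanSpace ℝ (Fin (n + 3)),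
      Integrable (fun u : Metric.sphere (0 : EuclideanSpace ℝ (Fin (n + 3))) 1 =>
        Real.exp (-‖θ‖ ^ 2 / 2) * (I (inner ℝ θ u) + I (-inner ℝ θ u))) σ ∧
      2 * ∫ x, lossDiff (n + 3) φ θ x =
        ∫ u : Metric.sphere (0 : EuclideanSpace ℝ (Fin (n + 3))) 1,
          Real.exp (-‖θ‖ ^ 2 / 2) * (I (inner ℝ θ u) + I (-inner ℝ θ u)) ∂σ := by
    intro θ
    obtain ⟨h1, h2⟩ := hpolar θ
    obtain ⟨h3, h4⟩ := hpolar (-θ)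
    simp only [norm_neg, inner_neg_left, integral_lossDiff_neg] at h3 h4
    simp only [mul_add]
    refine ⟨h1.add h3, ?_⟩
    rw [integral_add h1 h3, ← h2, ← h4, two_mul]
  have hmain := hΦ.integral_ray_nonpos hC n (I := I) (fun _ => rfl) hI0
  constructor
  · intro θ
    rw [risk_le_iff_integral_lossDiff hφm hK]
    have : ∫ u : Metric.sphere (0 : EuclideanSpace ℝ (Fin (n + 3))) 1,
        Real.exp (-‖θ‖ ^ 2 / 2) * (I (inner ℝ θ u) + I (-inner ℝ θ u)) ∂σ ≤ 0 :=
      integral_nonpos fun u =>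
        mul_nonpos_of_nonneg_of_nonpos (Real.exp_pos _).le (hmain _).1
    linarith [(hsym θ).2]
  -- Any unit vector serves: the directions not orthogonal to `θ` form an open set containing `θ`,
  -- hence of positive measure, and there the inequality is strict.
  · obtain ⟨θ, hθ⟩ := exists_norm_eq (EuclideanSpace ℝ (Fin (n + 3))) zero_le_one
    refine ⟨θ, ?_⟩
    rw [risk_lt_iff_integral_lossDiff hφm hK]
    have : 0 < ∫ u : Metric.sphere (0 : EuclideanSpace ℝ (Fin (n + 3))) 1,
        -(Real.exp (-‖θ‖ ^ 2 / 2) * (I (inner ℝ θ u) + I (-inner ℝ θ u))) ∂σ := by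
      refine (integral_pos_iff_support_of_nonneg ?_ (hsym θ).1.neg).2 ?_
      rotate_left
      · have hopen : IsOpen {u : Metric.sphere (0 : EuclideanSpace ℝ (Fin (n + 3))) 1 |
            inner ℝ θ (u : EuclideanSpace ℝ (Fin (n + 3))) ≠ 0} :=
          isOpen_ne_fun (by fun_prop) continuous_const
        refine (hopen.measure_pos σ ⟨⟨θ, by simpa using hθ⟩, ?_⟩).trans_le
          (measure_mono fun u hu => ?_)
        · simp [hθ]
        · exact neg_ne_zero.2 (mul_ne_zero (Real.exp_pos _).ne' ((hmain _).2 hu).ne)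
      · intro u
        exact neg_nonneg.2 (mul_nonpos_of_nonneg_of_nonpos (Real.exp_pos _).le (hmain _).1)
    rw [integral_neg] at this
    linarith [(hsym θ).2]

/-! ### Equivalence of the two descriptions of `φ`. -/

/-- A monotone derivative is continuous. -/
theorem continuous_of_hasDerivAt_of_monotone {F f : ℝ → ℝ} (hF : ∀ s, HasDerivAt F (f s) s)
    (hf : Monotone f) : Continuous f := by
  -- Adding the identity gives strict monotonicity; by Darboux the range is order-connected, and a
  -- strictly monotone map with such a range is an embedding.
  have hg : StrictMono fun s => f s + s := hf.add_strictMono strictMono_id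
  have hG : ∀ s, HasDerivAt (fun s => F s + s ^ 2 / 2) (f s + s) s := fun s => by
    have := (hF s).add (((hasDerivAt_id s).pow 2).div_const 2)
    refine this.congr_deriv ?_
    simp
  have hord : (range fun s => f s + s).OrdConnected := by
    rw [← image_univ]
    exact ordConnected_univ.image_hasDerivWithinAt fun s _ => (hG s).hasDerivWithinAt
  have hcont : Continuous fun s => f s + s := (hg.isEmbedding_of_ordConnected hord).continuous
  exact (hcont.sub continuous_id).congr fun s => add_sub_cancel_right (f s) s

theorem RateConditions.shrinkageConditions {Φ : ℝ → ℝ} (hΦ : RateConditions Φ)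
    (hcont : ContinuousOn Φ (Ioi 0)) {p : ℕ} (hp : 3 ≤ p) {C : ℝ} (hC : 1 / ((p : ℝ) - 2) ≤ C)
    {φ : ℝ → ℝ} (hφ : EqOn φ (shrinkageOfRate p Φ C) (Ioi 0)) : ShrinkageConditions p φ := by
  have hp' : (0 : ℝ) < (p : ℝ) - 2 := by
    have : (3 : ℝ) ≤ p := by exact_mod_cast hp
    linarith
  have hC0 : 0 < C := (one_div_pos.2 hp').trans_le hC
  have hpos : ∀ w, 0 < w → 0 < cumulativeRate Φ C w := fun w hw =>
    hC0.trans_le (hΦ.le_cumulativeRate C hw)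
  have hderiv : ∀ w, 0 < w → HasDerivAt φ (w⁻¹ * Φ w / cumulativeRate Φ C w ^ 2) w := by
    intro w hw
    have h1 := hΦ.hasDerivAt_cumulativeRate C hw (hcont.continuousAt (Ioi_mem_nhds hw))
    have h2 := (h1.inv (hpos w hw).ne').const_sub ((p : ℝ) - 2)
    refine (h2.congr_deriv (by ring)).congr_of_eventuallyEq ?_
    filter_upwards [Ioi_mem_nhds hw] with v hv
    rw [hφ hv, shrinkageOfRate_eq, one_div, Pi.inv_apply]
  -- Beyond a point `w₁` with `Φ w₁ > 0` the integral grows at least like `Φ w₁ * log w`.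
  have htop : Tendsto (cumulativeRate Φ C) atTop atTop := by
    obtain ⟨w₁, hw₁, hΦ₁⟩ := hΦ.exists_pos
    have h : Tendsto (fun w => Φ w₁ * (Real.log w - Real.log w₁)) atTop atTop :=
      (tendsto_atTop_add_const_right _ _ Real.tendsto_log_atTop).const_mul_atTop hΦ₁
    refine tendsto_atTop_mono' _ ?_ h
    filter_upwards [eventually_ge_atTop w₁] with w hw
    have hsplit := intervalIntegral.integral_add_adjacent_intervals (hΦ.integrable w₁ hw₁)
      ((hΦ.integrable w₁ hw₁).symm.trans (hΦ.integrable w (hw₁.trans_le hw)))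
    have hge : ∫ t in w₁..w, t⁻¹ * Φ w₁ ≤ ∫ t in w₁..w, t⁻¹ * Φ t := by
      refine intervalIntegral.integral_mono_on hw ?_
        ((hΦ.integrable w₁ hw₁).symm.trans (hΦ.integrable w (hw₁.trans_le hw))) fun t ht => ?_
      · refine ContinuousOn.intervalIntegrable fun t ht => ?_
        rw [uIcc_of_le hw] at ht
        exact ((continuousAt_inv₀ (hw₁.trans_le ht.1).ne').mul
          continuousAt_const).continuousWithinAt
      · have ht0 := hw₁.trans_le ht.1
        exact mul_le_mul_of_nonneg_left (hΦ.monotone hw₁ ht0 ht.1) (inv_nonneg.2 ht0.le)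
    rw [intervalIntegral.integral_mul_const, integral_inv_of_pos hw₁ (hw₁.trans_le hw),
      Real.log_div (hw₁.trans_le hw).ne' hw₁.ne'] at hge
    have h0 := hΦ.le_cumulativeRate 0 hw₁
    simp only [cumulativeRate] at h0 ⊢
    linarith
  constructor
  · exact fun w hw => (hderiv w hw).differentiableAt.differentiableWithinAt
  · intro w hw
    have := hΦ.nonneg w hw
    rw [(hderiv w hw).deriv]
    positivity
  · intro w hw
    rw [hφ hw, shrinkageOfRate_eq, sub_nonneg]
    calc 1 / cumulativeRate Φ C w ≤ 1 / (1 / ((p : ℝ) - 2)) :=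
          one_div_le_one_div_of_le (by positivity) (hC.trans (hΦ.le_cumulativeRate C hw))
      _ = _ := one_div_one_div _
  · have h : Tendsto (fun w => (p : ℝ) - 2 - 1 / cumulativeRate Φ C w) atTop
        (𝓝 ((p : ℝ) - 2 - 0)) := by
      simp only [one_div]
      exact tendsto_const_nhds.sub htop.inv_tendsto_atTop
    rw [sub_zero] at h
    refine h.congr' ?_
    filter_upwards [eventually_gt_atTop 0] with w hw using (hφ hw).symm
  · intro w hw h
    rw [hφ hw, shrinkageOfRate_eq] at h
    linarith [one_div_pos.2 (hpos w hw)]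
  · refine hΦ.monotone.congr fun w hw => ?_
    have h0 := (hpos w hw).ne'
    have h1 : w ≠ 0 := ne_of_gt hw
    rw [(hderiv w hw).deriv, hφ hw, shrinkageOfRate_eq]
    field_simp
    ring

/-- The substitution `ρ = 1/(p - 2 - φ)` linearizes the problem: `ρ' = w⁻¹ Φ` with `Φ` the given
quotient, so `ρ` is recovered by integration from its limit at `0`. -/
theorem ShrinkageConditions.exists_rate {p : ℕ} {φ : ℝ → ℝ} (h : ShrinkageConditions p φ) :
    ∃ (Φ : ℝ → ℝ) (C : ℝ), RateConditions Φ ∧ ContinuousOn Φ (Ioi 0) ∧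
      1 / ((p : ℝ) - 2) ≤ C ∧ EqOn φ (shrinkageOfRate p Φ C) (Ioi 0) := by
  have hdiff : ∀ w, 0 < w → HasDerivAt φ (deriv φ w) w := fun w hw =>
    (h.differentiable.differentiableAt (Ioi_mem_nhds hw)).hasDerivAt
  have hmono : MonotoneOn φ (Ioi 0) := by
    refine monotoneOn_of_deriv_nonneg (convex_Ioi 0) h.differentiable.continuousOn ?_ ?_
    · rw [interior_Ioi]
      exact h.differentiable
    · rw [interior_Ioi]
      exact h.deriv_nonneg
  have hlt : ∀ w, 0 < w → 0 < (p : ℝ) - 2 - φ w := by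
    intro w hw
    refine sub_pos.2 (lt_of_le_of_ne (ge_of_tendsto h.tendsto ?_) (h.ne w hw))
    filter_upwards [eventually_ge_atTop w] with v hv using hmono hw (hw.trans_le hv) hv
  set Φ : ℝ → ℝ := fun w => w * deriv φ w / ((p : ℝ) - 2 - φ w) ^ 2 with hΦ
  set ρ : ℝ → ℝ := fun w => 1 / ((p : ℝ) - 2 - φ w) with hρ
  have hρd : ∀ w, 0 < w → HasDerivAt ρ (w⁻¹ * Φ w) w := by
    intro w hw
    have := ((hdiff w hw).const_sub ((p : ℝ) - 2)).inv (hlt w hw).ne'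
    simp only [hρ, one_div]
    refine this.congr_deriv ?_
    simp only [hΦ]
    field_simp
  have hΦ0 : ∀ w, 0 < w → 0 ≤ Φ w := fun w hw => by
    have := h.deriv_nonneg w hw
    have := hlt w hw
    positivity
  have hρmono : MonotoneOn ρ (Ioi 0) := fun a ha b hb hab =>
    one_div_le_one_div_of_le (hlt b hb) (by linarith [hmono ha hb hab])
  have hρge : ∀ w, 0 < w → 1 / ((p : ℝ) - 2) ≤ ρ w := fun w hw =>
    one_div_le_one_div_of_le (hlt w hw) (by linarith [h.nonneg w hw])
  -- The limit exists since `ρ` is monotone and bounded below by `1/(p - 2)`, which also bounds `C`.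
  obtain ⟨C, hC⟩ : ∃ C, Tendsto ρ (𝓝[>] 0) (𝓝 C) :=
    ⟨_, hρmono.tendsto_nhdsGT ⟨1 / ((p : ℝ) - 2), by rintro _ ⟨w, hw, rfl⟩; exact hρge w hw⟩⟩
  set ρ₀ : ℝ → ℝ := Function.update ρ 0 C with hρ₀
  have hρ₀eq : ∀ w, 0 < w → ρ₀ w = ρ w := fun w hw => Function.update_of_ne hw.ne' _ _
  have hρ₀d : ∀ w, 0 < w → HasDerivAt ρ₀ (w⁻¹ * Φ w) w := fun w hw =>
    (hρd w hw).congr_of_eventuallyEq (by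
      filter_upwards [Ioi_mem_nhds hw] with v hv using hρ₀eq v hv)
  have hρ₀c : ContinuousOn ρ₀ (Ici 0) := by
    intro w hw
    rcases eq_or_lt_of_le (show (0 : ℝ) ≤ w from hw) with rfl | hw
    · rw [← continuousWithinAt_Ioi_iff_Ici, ContinuousWithinAt, hρ₀, Function.update_self]
      refine hC.congr' ?_
      filter_upwards [self_mem_nhdsWithin] with v hv using (hρ₀eq v hv).symm
    · exact (hρ₀d w hw).continuousAt.continuousWithinAt
  have hint : ∀ w, 0 < w → IntervalIntegrable (fun t => t⁻¹ * Φ t) volume 0 w := by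
    intro w hw
    refine intervalIntegral.intervalIntegrable_deriv_of_nonneg (g := ρ₀) ?_ ?_ ?_
    · rw [uIcc_of_le hw.le]
      exact hρ₀c.mono Icc_subset_Ici_self
    · intro t ht
      rw [min_eq_left hw.le] at ht
      exact hρ₀d t ht.1
    · intro t ht
      rw [min_eq_left hw.le] at ht
      exact mul_nonneg (inv_nonneg.2 (le_of_lt ht.1)) (hΦ0 t ht.1)
  have hcum : ∀ w, 0 < w → cumulativeRate Φ C w = ρ w := by
    intro w hw
    rw [cumulativeRate, intervalIntegral.integral_eq_sub_of_hasDerivAt_of_le hw.le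
      (hρ₀c.mono Icc_subset_Ici_self) (fun t ht => hρ₀d t ht.1) (hint w hw), hρ₀eq w hw, hρ₀,
      Function.update_self, sub_add_cancel]
  refine ⟨Φ, C, ⟨hΦ0, ?_, h.monotone_quotient, hint⟩, ?_, ?_, ?_⟩
  -- If `Φ` vanished, `φ` would be constant, hence equal to its limit `p - 2`, an excluded value.
  · by_contra! hno
    have hz : ∀ w ∈ Ioi (0 : ℝ), deriv φ w = 0 := fun w hw => by
      have h1 := le_antisymm (hno w hw) (hΦ0 w hw)
      have h2 := hlt w hw
      have h3 : w ≠ 0 := ne_of_gt hw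
      simpa [hΦ, h3, h2.ne'] using h1
    obtain ⟨c, hc⟩ := isOpen_Ioi.exists_is_const_of_deriv_eq_zero
      (convex_Ioi (0 : ℝ)).isPreconnected h.differentiable hz
    have hlim : Tendsto φ atTop (𝓝 c) := tendsto_const_nhds.congr' (by
      filter_upwards [eventually_gt_atTop 0] with w hw using (hc w hw).symm)
    exact h.ne 1 one_pos ((hc 1 (mem_Ioi.2 one_pos)).trans (tendsto_nhds_unique hlim h.tendsto))
  -- In the variable `s = log w` the factor `w⁻¹` disappears: `Φ ∘ exp` is itself the derivative of
  -- `ρ ∘ exp`.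
  · have hcomp : Continuous fun s => Φ (Real.exp s) := by
      refine continuous_of_hasDerivAt_of_monotone (F := fun s => ρ (Real.exp s)) (fun s => ?_) ?_
      · have := (hρd _ (Real.exp_pos s)).comp s (Real.hasDerivAt_exp s)
        refine this.congr_deriv ?_
        have := (Real.exp_pos s).ne'
        field_simp
      · exact fun a b hab =>
          h.monotone_quotient (Real.exp_pos a) (Real.exp_pos b) (Real.exp_le_exp.2 hab)
    have hlog : ContinuousOn Real.log (Ioi 0) :=
      Real.continuousOn_log.mono fun w hw => ne_of_gt hw
    refine (hcomp.comp_continuousOn hlog).congr fun w hw => ?_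
    simp only [Function.comp_apply, Real.exp_log hw]
  · refine ge_of_tendsto hC ?_
    filter_upwards [self_mem_nhdsWithin] with w hw using hρge w hw
  · intro w hw
    rw [shrinkageOfRate_eq, hcum w hw, hρ, one_div_one_div]
    ring

theorem theorem1 (p : ℕ) (hp : 3 ≤ p) :
    -- the main theorem
    (∀ φ : ℝ → ℝ, ShrinkageConditions p φ →
      risk (shrinkageEstimator p φ) 0 ≤ risk (jamesStein p) 0 →
      Dominates (shrinkageEstimator p φ) (jamesStein p)) ∧
    -- the reformulation, where `Φ` need not be continuous
    (∀ (Φ : ℝ → ℝ) (C : ℝ), RateConditions Φ → 1 / ((p : ℝ) - 2) ≤ C →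
      risk (shrinkageEstimator p (shrinkageOfRate p Φ C)) 0 ≤ risk (jamesStein p) 0 →
      Dominates (shrinkageEstimator p (shrinkageOfRate p Φ C)) (jamesStein p)) ∧
    -- the functions `φ` of the first part are exactly those given by a continuous `Φ`
    (∀ φ : ℝ → ℝ, ShrinkageConditions p φ ↔
      ∃ (Φ : ℝ → ℝ) (C : ℝ), RateConditions Φ ∧ ContinuousOn Φ (Ioi 0) ∧
        1 / ((p : ℝ) - 2) ≤ C ∧ EqOn φ (shrinkageOfRate p Φ C) (Ioi 0)) := by
  have hp' : (0 : ℝ) < (p : ℝ) - 2 := by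
    have : (3 : ℝ) ≤ p := by exact_mod_cast hp
    linarith
  have hrate : ∀ (Φ : ℝ → ℝ) (C : ℝ), RateConditions Φ → 1 / ((p : ℝ) - 2) ≤ C →
      risk (shrinkageEstimator p (shrinkageOfRate p Φ C)) 0 ≤ risk (jamesStein p) 0 →
      Dominates (shrinkageEstimator p (shrinkageOfRate p Φ C)) (jamesStein p) :=
    fun Φ C hΦ hC h0 => hΦ.dominates hp ((one_div_pos.2 hp').trans_le hC) h0
  refine ⟨fun φ hφ h0 => ?_, hrate, fun φ => ⟨fun hφ => hφ.exists_rate, ?_⟩⟩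
  · obtain ⟨Φ, C, hΦ, -, hC, heq⟩ := hφ.exists_rate
    rw [shrinkageEstimator_congr heq] at h0 ⊢
    exact hrate Φ C hΦ hC h0
  · rintro ⟨Φ, C, hΦ, hcont, hC, heq⟩
    exact hΦ.shrinkageConditions hcont hp hC heq
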